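/- Let $x=\{x_1,\dots,x_n\}$ be a finite set of variables. Let $I=Q\cap J$ be ideals of $\mathbb Z[x]$ such that $I$ is pseudo-primary, i.e. $P:=\sqrt I$ is prime, $Q$ is $P$-primary, and $\operatorname{ht}Q<\operatorname{ht}J$ (with $\operatorname{ht}\langle 1\rangle=\infty$). Suppose $P\cap\mathbb Z=\langle p\rangle$ for a prime number $p$, and let $u\subseteq x$ be a maximal independent set of variables for $\overline P:=P\,\mathbb F_p[x]$, i.e. $\overline P\cap\mathbb F_p[u]=\langle 0\rangle$ and $\#u=\dim(\mathbb F_p[x]/\overline P)$. Put $R:=\mathbb Z[u]_{\langle p\rangle}$, the localization of $\mathbb Z[u]$ at the prime ideal $\langle p\rangle$, so that $\mathbb Z[x]\subseteq R[x\smallsetminus u]$. For a commutative ring $A$ and a global monomial ordering (one that is a well-ordering), $\mathrm{LT}(f)$ denotes the leading term of $f$, including its coefficient. A subset $G$ of an ideal $I'$ of a polynomial ring over $A$ is called a strong Gröbner basis of $I'$ if for every nonzero $f\in I'$ there is $g\in G$ with $\mathrm{LT}(g)\mid\mathrm{LT}(f)$. A block ordering with $x\smallsetminus u\gg u$ is a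 monomial ordering on $x$ which compares two monomials first in the variables $x\smallsetminus u$ by a monomial ordering $>_1$ and, in case of equality there, in the variables $u$ by a monomial ordering $>_2$; the ordering it induces on the variables $x\smallsetminus u$ is $>_1$. Then: 1. $I\,R[x\smallsetminus u]\cap\mathbb Z[x]=Q$. 2. If $G$ is a strong Gröbner basis of $I$ with respect to a block ordering with $x\smallsetminus u\gg u$, then $G$ is a strong Gröbner basis of $I\,R[x\smallsetminus u]$ with respect to the induced ordering on the variables $x\smallsetminus u$. 3. Let $G=\{g_1,\dots,g_k\}$ be a finite strong Gröbner basis of $I$ as in (2), whose leading terms in $R[x\smallsetminus u]$ with respect to the induced ordering are $p^{\nu_i}a_i(x\smallsetminus u)^{\beta_i}$ with $\nu_i\ge 0$ and $a_i\in\mathbb Z[u]\smallsetminus\langle p\rangle$ for $i=1,\dots,k$, and let $h\in\mathbb Z[u]$ be a least common multiple of $a_1,\dots,a_k$ in $\mathbb Z[u]$. Then $I\,R[x\smallsetminus u]\cap\mathbb Z[x]=I:h^\infty$, where $I:h^\infty=\{f\in\mathbb Z[x] : h^mf\in I\text{ for some } m\ge 0\}$. -/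

import Mathlib

/-- An ideal is pseudo-primary if its radical is prime. -/
def IsPseudoPrimary {A : Type*} [CommRing A] (I : Ideal A) : Prop :=
  I.radical.IsPrime

/-- The saturation `I : h^∞`, i.e. the union over `m` of the ideal quotients `I : h^m`. -/
def saturationIdeal {A : Type*} [CommRing A] (I : Ideal A) (h : A) : Ideal A where
  carrier := {f | ∃ m : ℕ, h ^ m * f ∈ I}
  zero_mem' := ⟨0, by simp⟩
  add_mem' := by
    rintro f g ⟨k, hk⟩ ⟨l, hl⟩
    refine ⟨k + l, ?_⟩
    have e : h ^ (k + l) * (f + g) = h ^ l * (h ^ k * f) + h ^ k * (h ^ l * g) := by ring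
    rw [e]
    exact I.add_mem (I.mul_mem_left _ hk) (I.mul_mem_left _ hl)
  smul_mem' := by
    rintro c f ⟨k, hk⟩
    refine ⟨k, ?_⟩
    have e : h ^ k * (c • f) = c * (h ^ k * f) := by rw [smul_eq_mul]; ring
    rw [e]
    exact I.mul_mem_left _ hk

/-- `h` is a least common multiple of the family `a` (determined up to a unit). -/
def IsLeastCommonMultiple {A ι : Type*} [CommRing A] (a : ι → A) (h : A) : Prop :=
  (∀ i, a i ∣ h) ∧ ∀ c, (∀ i, a i ∣ c) → h ∣ c

/-- `G` is a strong Gröbner basis of the ideal `I` with respect to the (global) monomial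
ordering `m`: `G ⊆ I`, and the leading term (leading monomial together with its
coefficient) of every nonzero `f ∈ I` is divisible by the leading term of some `g ∈ G`. -/
def IsStrongGroebnerBasis {σ A : Type*} [CommRing A] (m : MonomialOrder σ)
    (G : Set (MvPolynomial σ A)) (I : Ideal (MvPolynomial σ A)) : Prop :=
  G ⊆ (I : Set (MvPolynomial σ A)) ∧
    ∀ f ∈ I, f ≠ 0 → ∃ g ∈ G, m.leadingTerm g ∣ m.leadingTerm f

/-- `m` is the block ordering with `x ∖ u ≫ u` built from the ordering `m₁` on the
variables `x ∖ u` and the ordering `m₂` on the variables `u`: exponents are compared first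
in the variables `x ∖ u` by `m₁`, and ties are broken in the variables `u` by `m₂`.
The ordering induced on `x ∖ u` is then `m₁`. -/
def IsBlockOrder {σ : Type*} (u : Finset σ) (m : MonomialOrder σ)
    (m₁ : MonomialOrder {i // i ∉ u}) (m₂ : MonomialOrder {i // i ∈ u}) : Prop :=
  ∀ a b : σ →₀ ℕ, m.toSyn a < m.toSyn b ↔
    (m₁.toSyn (a.subtypeDomain (· ∉ u)) < m₁.toSyn (b.subtypeDomain (· ∉ u)) ∨
      (a.subtypeDomain (· ∉ u) = b.subtypeDomain (· ∉ u) ∧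
        m₂.toSyn (a.subtypeDomain (· ∈ u)) < m₂.toSyn (b.subtypeDomain (· ∈ u))))

/-- The inclusion `A[u] → A[x]` for a set of variables `u ⊆ x`. -/
noncomputable def inclVars {σ : Type*} (A : Type*) [CommRing A] (u : Finset σ) :
    MvPolynomial {i // i ∈ u} A →+* MvPolynomial σ A :=
  (MvPolynomial.rename (R := A) (Subtype.val : {i // i ∈ u} → σ)).toRingHom

/-- `u ⊆ x` is a maximal independent set of variables for an ideal `P` of `K[x]`:
`P ∩ K[u] = 0` and `#u = dim (K[x] / P)`. -/
def IsMaximalIndependentSet {σ K : Type*} [Field K] (u : Finset σ)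
    (P : Ideal (MvPolynomial σ K)) : Prop :=
  P.comap (inclVars K u) = ⊥ ∧
    ringKrullDim (MvPolynomial σ K ⧸ P) = (u.card : WithBot ℕ∞)

/-- The ideal `⟨p⟩` of `ℤ[u]`. -/
noncomputable def pIdeal {σ : Type*} (p : ℕ) (u : Finset σ) :
    Ideal (MvPolynomial {i // i ∈ u} ℤ) :=
  Ideal.span {(p : MvPolynomial {i // i ∈ u} ℤ)}

instance pIdeal_isPrime {σ : Type*} (p : ℕ) [hp : Fact p.Prime] (u : Finset σ) :
    (pIdeal p u).IsPrime := by
  have h1 : Prime (p : ℤ) := Nat.prime_iff_prime_int.mp hp.out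
  have h2 : Prime (MvPolynomial.C (p : ℤ) : MvPolynomial {i // i ∈ u} ℤ) :=
    (MvPolynomial.prime_C_iff _).mpr h1
  have h3 : (MvPolynomial.C (p : ℤ) : MvPolynomial {i // i ∈ u} ℤ) = (p : _) := by simp
  rw [h3] at h2
  exact (Ideal.span_singleton_prime h2.ne_zero).mpr h2

/-- The local ring `R = ℤ[u]_⟨p⟩`. -/
abbrev LocCoeff {σ : Type*} (p : ℕ) [Fact p.Prime] (u : Finset σ) : Type _ :=
  Localization.AtPrime (pIdeal p u)

open Classical in
/-- The inclusion `ℤ[x] → R[x ∖ u]`, where `R = ℤ[u]_⟨p⟩`: a variable in `u` goes to the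
corresponding constant of `R`, a variable not in `u` to the corresponding variable. -/
noncomputable def toLocPoly {σ : Type*} (p : ℕ) [Fact p.Prime] (u : Finset σ) :
    MvPolynomial σ ℤ →+* MvPolynomial {i // i ∉ u} (LocCoeff p u) :=
  MvPolynomial.eval₂Hom
    ((MvPolynomial.C.comp (algebraMap (MvPolynomial {i // i ∈ u} ℤ) (LocCoeff p u))).comp
      MvPolynomial.C) fun i =>
    if h : i ∈ u then
      MvPolynomial.C (algebraMap (MvPolynomial {i // i ∈ u} ℤ) (LocCoeff p u)
        (MvPolynomial.X ⟨i, h⟩))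
    else MvPolynomial.X ⟨i, h⟩

/-!
Let `S = ℤ[u] ∖ ⟨p⟩`. Splitting the variables identifies `ℤ[x]` with `ℤ[u][x ∖ u]`
(`splitVars`), and `R[x ∖ u]` is then the localization of `ℤ[x]` at `S`. Hence
`I R[x ∖ u] ∩ ℤ[x]` consists of the `f` with `s f ∈ I` for some `s ∈ S`
(`mem_comap_map_toLocPoly_iff`).

*Contraction.* Independence of `u` says that `S` misses `P`, so that a multiplier from `S` can be
cancelled modulo the `P`-primary ideal `Q`. It remains to see that `S` meets `J`. Otherwise some
prime `N ⊇ J` misses `S`; it contains `P = √I`. Modulo `p`, independence together with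
`dim F_p[x] / P̄ = #u` makes `u` a transcendence basis of `F_p[x] / P̄`
(via Noether normalization and going up, `trdeg_le_ringKrullDim`), so every nonzero ideal of this
domain contains a nonzero polynomial in `u`. As `N̄` contains none, `N = P`, which contradicts
`ht P = ht Q < ht J` (`exists_inclVars_mem_of_height_lt`).

*Gröbner bases.* A nonzero element of `R` is a unit times a power of `p`, so what matters about a
leading coefficient over `R` is its `p`-adic valuation. If `f ∈ I` has leading coefficient
`c ∈ ℤ[u]` with `q ∤ c`, reduce `f` modulo `G` with respect to the block ordering. As long as
the leading coefficients in `ℤ[u]` of the elements of `G` used are divisible by `q`, a reduction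
step changes neither the leading monomial in `x ∖ u` nor the class of the coefficient modulo `q`,
while the leading monomial in `x` drops. So eventually some `g ∈ G` is used whose leading
coefficient is not divisible by `q`
(`IsStrongGroebnerBasis.exists_not_dvd_leadingCoeff`); take `q = p ^ (v + 1)`, where `v` is the
valuation of `c`.

*Saturation.* The leading coefficients of the `g i` are `p ^ ν i * a i` and every `a i` divides `h`.
For `f` in the contraction, `p ^ ν i` divides the leading coefficient of `f` in `ℤ[u]` for a
suitable `i`, so `h f` can be reduced by `g i` over `ℤ[u]`: the division algorithm works after
multiplication by `h` in each step.
-/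

open MvPolynomial

/-! ### Independent sets of variables and transcendence bases -/

/-- By lying over and going up, chains of primes lift along an integral extension. -/
theorem ringKrullDim_le_of_isIntegral (R S : Type*) [CommRing R] [CommRing S] [Algebra R S]
    [Algebra.IsIntegral R S] [FaithfulSMul R S] : ringKrullDim R ≤ ringKrullDim S := by
  refine iSup_le fun l => ?_
  obtain ⟨⟨Q, hQ, hlo⟩⟩ := Ideal.nonempty_primesOver (S := S) l.head.asIdeal
  obtain ⟨L, hL, -⟩ := Ideal.exists_ltSeries_of_hasGoingUp l Q
  rw [← hL]
  exact le_iSup (fun L : LTSeries (PrimeSpectrum S) => (L.length : WithBot ℕ∞)) L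

/-- By Noether normalization, `A` is integral over a polynomial ring in `s` variables; then `s` is the
transcendence degree of `A`, and `s ≤ dim A`. -/
theorem trdeg_le_ringKrullDim (K A : Type*) [Field K] [CommRing A] [IsDomain A] [Algebra K A]
    [Algebra.FiniteType K A] {d : ℕ} (hd : ringKrullDim A ≤ d) :
    Algebra.trdeg K A ≤ d := by
  obtain ⟨s, g, hg, hint⟩ := exists_integral_inj_algHom_of_fg K A
  algebraize [g.toRingHom]
  have : FaithfulSMul (MvPolynomial (Fin s) K) A :=
    (faithfulSMul_iff_algebraMap_injective _ _).mpr hg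
  have : Algebra.IsIntegral (MvPolynomial (Fin s) K) A := ⟨hint⟩
  have : IsScalarTower K (MvPolynomial (Fin s) K) A :=
    IsScalarTower.of_algebraMap_eq' g.comp_algebraMap.symm
  have h1 := (ringKrullDim_le_of_isIntegral (MvPolynomial (Fin s) K) A).trans hd
  rw [MvPolynomial.ringKrullDim_of_isNoetherianRing, ringKrullDim_eq_zero_of_field, zero_add,
    Nat.card_fin] at h1
  have h2 := lift_trdeg_add_eq K (MvPolynomial (Fin s) K) A
  rw [MvPolynomial.trdeg_of_isDomain, trdeg_eq_zero] at h2
  simp at h2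
  rw [← h2]
  exact_mod_cast h1

theorem isAlgebraic_of_ringKrullDim_le_card {K A ι : Type*} [Field K] [CommRing A] [IsDomain A]
    [Algebra K A] [Algebra.FiniteType K A] [Fintype ι] {x : ι → A} (hx : AlgebraicIndependent K x)
    (hd : ringKrullDim A ≤ Fintype.card ι) :
    Algebra.IsAlgebraic (Algebra.adjoin K (Set.range x)) A := by
  refine IsTranscendenceBasis.isAlgebraic
    (hx.isTranscendenceBasis_of_lift_trdeg_le_of_finite ?_)
  have := trdeg_le_ringKrullDim K A hd
  simpa using this

/-- A prime `P` is maximal among the ideals that contain no nonzero polynomial in `u`, when `u` is a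
maximal independent set for `P`: as `K[x] / P` is algebraic over `K[u]`, each of its nonzero ideals
meets `K[u]` nontrivially. -/
theorem IsMaximalIndependentSet.eq_of_le {σ K : Type*} [Finite σ] [Field K] {u : Finset σ}
    {P N : Ideal (MvPolynomial σ K)} [P.IsPrime] (hu : IsMaximalIndependentSet u P) (hPN : P ≤ N)
    (hN : N.comap (inclVars K u) = ⊥) : N = P := by
  obtain ⟨hP, hdim⟩ := hu
  let x : {i // i ∈ u} → MvPolynomial σ K ⧸ P := fun i => Ideal.Quotient.mk P (MvPolynomial.X i.1)
  have hev (f : MvPolynomial {i // i ∈ u} K) :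
      MvPolynomial.aeval x f = Ideal.Quotient.mk P (inclVars K u f) := by
    have h : MvPolynomial.aeval x =
        (Ideal.Quotient.mkₐ K P).comp (MvPolynomial.rename Subtype.val) := by
      ext i
      simp [x]
    exact congr($h f)
  have hx : AlgebraicIndependent K x := by
    rw [algebraicIndependent_iff]
    intro f hf
    rw [hev, Ideal.Quotient.eq_zero_iff_mem] at hf
    have : f ∈ P.comap (inclVars K u) := hf
    rwa [hP] at this
  have halg := isAlgebraic_of_ringKrullDim_le_card hx (by simp [hdim])
  refine le_antisymm (fun f hf => ?_) hPN
  by_contra hfP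
  have hmap : Ideal.Quotient.mk P f ∈ N.map (Ideal.Quotient.mk P) := Ideal.mem_map_of_mem _ hf
  apply Ideal.comap_ne_bot_of_algebraic_mem (R := Algebra.adjoin K (Set.range x))
    (mt Ideal.Quotient.eq_zero_iff_mem.mp hfP) hmap (halg.isAlgebraic _)
  rw [eq_bot_iff]
  rintro ⟨y, hy⟩ hyN
  rw [Algebra.adjoin_range_eq_range_aeval] at hy
  obtain ⟨q, rfl⟩ := hy
  replace hyN : MvPolynomial.aeval x q ∈ N.map (Ideal.Quotient.mk P) := hyN
  rw [hev, ← Ideal.mem_comap, Ideal.comap_map_of_surjective _ Ideal.Quotient.mk_surjective,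
    ← RingHom.ker_eq_comap_bot, Ideal.mk_ker, sup_eq_left.mpr hPN, ← Ideal.mem_comap, hN] at hyN
  rw [Ideal.mem_bot] at hyN ⊢
  subst hyN
  ext
  simp

/-! ### Splitting the variables and localizing the coefficients -/

open Classical in
/-- The isomorphism `A[x] ≃ A[u][x ∖ u]` which regards a polynomial as one in the variables outside
`u`, with coefficients in `A[u]`. -/
noncomputable def splitVars {σ : Type*} (A : Type*) [CommRing A] (u : Finset σ) :
    MvPolynomial σ A ≃+* MvPolynomial {i // i ∉ u} (MvPolynomial {i // i ∈ u} A) :=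
  RingEquiv.ofRingHom
    (eval₂Hom (C.comp C) fun i => if h : i ∈ u then C (X ⟨i, h⟩) else X ⟨i, h⟩)
    (eval₂Hom (inclVars A u) fun i => X i.1)
    (by
      ext i
      · simp [inclVars]
      · simp [inclVars]
      · simp [i.2])
    (by
      ext i
      · simp [inclVars]
      · by_cases h : i ∈ u <;> simp [inclVars, h])

section
variable {σ A : Type*} [CommRing A] (u : Finset σ)

theorem splitVars_inclVars (f : MvPolynomial {i // i ∈ u} A) :
    splitVars A u (inclVars A u f) = C f := by
  rw [← RingEquiv.eq_symm_apply]
  simp [splitVars]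

theorem splitVars_monomial (e : σ →₀ ℕ) (r : A) :
    splitVars A u (monomial e r) =
      monomial (e.subtypeDomain (· ∉ u)) (monomial (e.subtypeDomain (· ∈ u)) r) := by
  rw [← RingEquiv.eq_symm_apply]
  have h : e = (e.subtypeDomain (· ∈ u)).mapDomain Subtype.val +
      (e.subtypeDomain (· ∉ u)).mapDomain Subtype.val := by
    ext i
    by_cases hi : i ∈ u
    · have h1 := Finsupp.mapDomain_apply (Subtype.val_injective (p := (· ∈ u)))
        (e.subtypeDomain (· ∈ u)) ⟨i, hi⟩
      have h2 := Finsupp.mapDomain_of_notMem_range (f := (Subtype.val : {i // i ∉ u} → σ))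
        (e.subtypeDomain (· ∉ u)) i (by simpa using hi)
      simp_all
    · have h1 := Finsupp.mapDomain_apply (Subtype.val_injective (p := (· ∉ u)))
        (e.subtypeDomain (· ∉ u)) ⟨i, hi⟩
      have h2 := Finsupp.mapDomain_of_notMem_range (f := (Subtype.val : {i // i ∈ u} → σ))
        (e.subtypeDomain (· ∈ u)) i (by simpa using hi)
      simp_all
  have h' : (e.subtypeDomain (· ∉ u)).prod (fun i k => (X i.1 ^ k : MvPolynomial σ A)) =
      monomial ((e.subtypeDomain (· ∉ u)).mapDomain Subtype.val) 1 := by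
    rw [← rename_monomial, monomial_eq]
    simp [Finsupp.prod, map_prod]
  have h'' : inclVars A u (monomial (e.subtypeDomain (· ∈ u)) r) =
      monomial ((e.subtypeDomain (· ∈ u)).mapDomain Subtype.val) r := rename_monomial _ _ _
  rw [splitVars, RingEquiv.ofRingHom_symm_apply, eval₂Hom_monomial, h', h'', monomial_mul, mul_one,
    ← h]

theorem coeff_coeff_splitVars (f : MvPolynomial σ A) (e : σ →₀ ℕ) :
    coeff (e.subtypeDomain (· ∈ u)) (coeff (e.subtypeDomain (· ∉ u)) (splitVars A u f)) =
      coeff e f := by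
  classical
  induction f using MvPolynomial.induction_on' with
  | add f g hf hg => simp [hf, hg]
  | monomial d r =>
    rw [splitVars_monomial, coeff_monomial, coeff_monomial]
    have h : d = e ↔ d.subtypeDomain (· ∉ u) = e.subtypeDomain (· ∉ u) ∧
        d.subtypeDomain (· ∈ u) = e.subtypeDomain (· ∈ u) := by
      refine ⟨by rintro rfl; exact ⟨rfl, rfl⟩, fun ⟨h1, h2⟩ => ?_⟩
      ext i
      by_cases hi : i ∈ u
      · exact DFunLike.congr_fun h2 ⟨i, hi⟩
      · exact DFunLike.congr_fun h1 ⟨i, hi⟩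
    by_cases h1 : d.subtypeDomain (· ∉ u) = e.subtypeDomain (· ∉ u) <;>
      simp [h, h1, coeff_monomial]

end

section
variable {σ : Type*} (p : ℕ) [Fact p.Prime] (u : Finset σ)

/-- `toLocPoly` splits the variables and then localizes the coefficients. -/
theorem toLocPoly_apply (f : MvPolynomial σ ℤ) :
    toLocPoly p u f = map (algebraMap (MvPolynomial {i // i ∈ u} ℤ) (LocCoeff p u))
      (splitVars ℤ u f) := by
  have h : toLocPoly p u = (map (algebraMap (MvPolynomial {i // i ∈ u} ℤ) (LocCoeff p u))).comp
      (splitVars ℤ u).toRingHom := by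
    ext i : 2
    · simp
    · by_cases hi : i ∈ u <;> simp [toLocPoly, splitVars, hi]
  rw [h]
  rfl

theorem algebraMap_locCoeff_injective :
    Function.Injective (algebraMap (MvPolynomial {i // i ∈ u} ℤ) (LocCoeff p u)) :=
  IsLocalization.injective _ (pIdeal p u).primeCompl_le_nonZeroDivisors

theorem toLocPoly_injective : Function.Injective (toLocPoly p u) := by
  intro f g h
  rw [toLocPoly_apply, toLocPoly_apply] at h
  exact (splitVars ℤ u).injective (map_injective _ (algebraMap_locCoeff_injective p u) h)

theorem toLocPoly_inclVars (s : MvPolynomial {i // i ∈ u} ℤ) :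
    toLocPoly p u (inclVars ℤ u s) = C (algebraMap _ (LocCoeff p u) s) := by
  rw [toLocPoly_apply, splitVars_inclVars, map_C]

attribute [local instance] MvPolynomial.algebraMvPolynomial in
/-- `R[x ∖ u]` is a localization of `ℤ[x]`: an element of the extension of `I` is a fraction with
numerator in `I` and denominator in `ℤ[u] ∖ ⟨p⟩`. -/
theorem mem_map_toLocPoly_iff {I : Ideal (MvPolynomial σ ℤ)}
    {F : MvPolynomial {i // i ∉ u} (LocCoeff p u)} :
    F ∈ I.map (toLocPoly p u) ↔ ∃ s ∉ pIdeal p u, ∃ f ∈ I,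
      C (algebraMap _ (LocCoeff p u) s) * F = toLocPoly p u f := by
  constructor
  · intro hF
    have hI : I.map (toLocPoly p u) = (I.map (splitVars ℤ u).toRingHom).map
        (algebraMap (MvPolynomial {i // i ∉ u} (MvPolynomial {i // i ∈ u} ℤ))
          (MvPolynomial {i // i ∉ u} (LocCoeff p u))) := by
      rw [Ideal.map_map]
      congr 1
      refine RingHom.ext fun f => ?_
      exact toLocPoly_apply p u f
    rw [hI, IsLocalization.mem_map_algebraMap_iff ((pIdeal p u).primeCompl.map C)] at hF
    obtain ⟨⟨⟨a, ha⟩, ⟨_, s, hs, rfl⟩⟩, h⟩ := hF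
    rw [Ideal.mem_map_iff_of_surjective (splitVars ℤ u).toRingHom (splitVars ℤ u).surjective] at ha
    obtain ⟨f, hf, rfl⟩ := ha
    refine ⟨s, hs, f, hf, ?_⟩
    rw [toLocPoly_apply, mul_comm, ← map_C]
    exact h
  · rintro ⟨s, hs, f, hf, h⟩
    have hu : IsUnit (C (σ := {i // i ∉ u}) (algebraMap _ (LocCoeff p u) s)) :=
      (IsLocalization.map_units (M := (pIdeal p u).primeCompl) _ ⟨s, hs⟩).map C
    rw [← Ideal.unit_mul_mem_iff_mem _ hu, h]
    exact Ideal.mem_map_of_mem _ hf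

theorem mem_comap_map_toLocPoly_iff {I : Ideal (MvPolynomial σ ℤ)} {f : MvPolynomial σ ℤ} :
    f ∈ (I.map (toLocPoly p u)).comap (toLocPoly p u) ↔
      ∃ s ∉ pIdeal p u, inclVars ℤ u s * f ∈ I := by
  rw [Ideal.mem_comap, mem_map_toLocPoly_iff]
  refine exists_congr fun s => and_congr_right fun _ => ?_
  rw [← toLocPoly_inclVars, ← map_mul]
  constructor
  · rintro ⟨g, hg, h⟩
    rwa [toLocPoly_injective p u h]
  · exact fun h => ⟨_, h, rfl⟩

end

/-! ### The contraction of the extended ideal -/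

section
variable {σ : Type*} (p : ℕ) (u : Finset σ)

theorem ker_map_castRingHom_zmod (τ : Type*) :
    RingHom.ker (map (σ := τ) (Int.castRingHom (ZMod p))) =
      Ideal.span {(p : MvPolynomial τ ℤ)} := by
  rw [MvPolynomial.ker_map, ZMod.ker_intCastRingHom, Ideal.map_span, Set.image_singleton]
  simp

theorem map_castRingHom_zmod_surjective (τ : Type*) :
    Function.Surjective (map (σ := τ) (Int.castRingHom (ZMod p))) :=
  map_surjective _ (ZMod.ringHom_surjective _)

theorem map_inclVars {A B : Type*} [CommRing A] [CommRing B] (φ : A →+* B)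
    (f : MvPolynomial {i // i ∈ u} A) :
    map φ (inclVars A u f) = inclVars B u (map φ f) :=
  map_rename _ _ _

/-- For an ideal containing `p`, independence of `u` modulo the reduction of `N` to `F_p[x]` means
that `N` contains no element of `ℤ[u] ∖ ⟨p⟩`. -/
theorem comap_inclVars_eq_bot_iff {N : Ideal (MvPolynomial σ ℤ)} (hp : (p : MvPolynomial σ ℤ) ∈ N) :
    (N.map (map (Int.castRingHom (ZMod p)))).comap (inclVars (ZMod p) u) = ⊥ ↔
      N.comap (inclVars ℤ u) ≤ pIdeal p u := by
  have hker : N ⊔ (⊥ : Ideal _).comap (map (Int.castRingHom (ZMod p))) = N := by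
    rw [← RingHom.ker_eq_comap_bot, ker_map_castRingHom_zmod, sup_eq_left]
    simpa [Ideal.span_le] using hp
  have key (g : MvPolynomial {i // i ∈ u} ℤ) :
      map (Int.castRingHom (ZMod p)) g ∈
        (N.map (map (Int.castRingHom (ZMod p)))).comap (inclVars (ZMod p) u) ↔
      g ∈ N.comap (inclVars ℤ u) := by
    rw [Ideal.mem_comap, ← map_inclVars, ← Ideal.mem_comap,
      Ideal.comap_map_of_surjective _ (map_castRingHom_zmod_surjective p σ), hker]
    rfl
  rw [pIdeal, ← ker_map_castRingHom_zmod]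
  constructor
  · intro h g hg
    rwa [← key, h] at hg
  · refine fun h => eq_bot_iff.mpr fun g hg => ?_
    obtain ⟨g, rfl⟩ := map_castRingHom_zmod_surjective p _ g
    exact h ((key g).mp hg)

variable [hpr : Fact p.Prime] [Finite σ] {u}

/-- The lift of `IsMaximalIndependentSet.eq_of_le` from `F_p[x]` to `ℤ[x]`. -/
theorem IsMaximalIndependentSet.eq_of_le_of_comap_inclVars_le {P N : Ideal (MvPolynomial σ ℤ)}
    [P.IsPrime] (hpP : (p : MvPolynomial σ ℤ) ∈ P)
    (hu : IsMaximalIndependentSet u (P.map (map (σ := σ) (Int.castRingHom (ZMod p)))))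
    (hPN : P ≤ N) (hN : N.comap (inclVars ℤ u) ≤ pIdeal p u) : N = P := by
  have hker {M : Ideal (MvPolynomial σ ℤ)} (hM : P ≤ M) :
      RingHom.ker (map (σ := σ) (Int.castRingHom (ZMod p))) ≤ M := by
    rw [ker_map_castRingHom_zmod]
    simpa [Ideal.span_le] using hM hpP
  have hsurj := map_castRingHom_zmod_surjective p σ
  have : (P.map (map (σ := σ) (Int.castRingHom (ZMod p)))).IsPrime :=
    Ideal.map_isPrime_of_surjective hsurj (hker le_rfl)
  have h := hu.eq_of_le (Ideal.map_mono hPN) ((comap_inclVars_eq_bot_iff p u (hPN hpP)).mpr hN)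
  have hcm {M : Ideal (MvPolynomial σ ℤ)} (hM : P ≤ M) :
      (M.map (map (Int.castRingHom (ZMod p)))).comap (map (Int.castRingHom (ZMod p))) = M := by
    rw [Ideal.comap_map_of_surjective _ hsurj, ← RingHom.ker_eq_comap_bot, sup_eq_left]
    exact hker hM
  rw [← hcm hPN, h, hcm le_rfl]

/-- If `u` is a maximal independent set for `P` modulo `p`, then every ideal `J` of larger height whose
radical contains `P` meets `ℤ[u] ∖ ⟨p⟩`: otherwise a prime containing `J` and disjoint from this set
would be equal to `P`. -/
theorem exists_inclVars_mem_of_height_lt {P J : Ideal (MvPolynomial σ ℤ)} [P.IsPrime]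
    (hpP : (p : MvPolynomial σ ℤ) ∈ P)
    (hu : IsMaximalIndependentSet u (P.map (map (σ := σ) (Int.castRingHom (ZMod p)))))
    (hPJ : P ≤ J.radical) (hht : P.height < J.height) :
    ∃ s ∉ pIdeal p u, inclVars ℤ u s ∈ J := by
  by_contra! h
  obtain ⟨N, hNp, hJN, hdisj⟩ := Ideal.exists_le_prime_disjoint J
    ((pIdeal p u).primeCompl.map (inclVars ℤ u)) (by
      rw [Set.disjoint_left]
      rintro _ hJ ⟨s, hs, rfl⟩
      exact h s hs hJ)
  have hPN : P ≤ N := hPJ.trans (hNp.radical_le_iff.mpr hJN)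
  have hN : N.comap (inclVars ℤ u) ≤ pIdeal p u := by
    intro s hs
    by_contra hsp
    exact Set.disjoint_left.mp hdisj hs ⟨s, hsp, rfl⟩
  rw [← hu.eq_of_le_of_comap_inclVars_le p hpP hPN hN] at hht
  exact (Ideal.height_mono hJN).not_gt hht

theorem comap_map_toLocPoly_eq_of_height_lt {Q J P : Ideal (MvPolynomial σ ℤ)}
    (hQ : Q.IsPrimary) (hQP : Q.radical = P) (hPJ : P ≤ J.radical) (hht : Q.height < J.height)
    (hpP : (p : MvPolynomial σ ℤ) ∈ P)
    (hu : IsMaximalIndependentSet u (P.map (map (σ := σ) (Int.castRingHom (ZMod p))))) :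
    ((Q ⊓ J).map (toLocPoly p u)).comap (toLocPoly p u) = Q := by
  have hPprime : P.IsPrime := hQP ▸ Ideal.isPrime_radical hQ
  ext f
  rw [mem_comap_map_toLocPoly_iff]
  constructor
  · rintro ⟨s, hs, hf⟩
    have hsP : inclVars ℤ u s ∉ Q.radical := by
      rw [hQP]
      exact fun h => hs ((comap_inclVars_eq_bot_iff p u hpP).mp hu.1 h)
    exact ((Ideal.isPrimary_iff.mp hQ).2 (by rw [mul_comm]; exact hf.1)).resolve_right hsP
  · intro hf
    have hht' : P.height < J.height := by
      rwa [← hQP, Ideal.height_eq_inf_minimalPrimes, Ideal.radical_minimalPrimes,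
        ← Ideal.height_eq_inf_minimalPrimes]
    obtain ⟨s, hs, hsJ⟩ := exists_inclVars_mem_of_height_lt p hpP hu hPJ hht'
    exact ⟨s, hs, Q.mul_mem_left _ hf, J.mul_mem_right _ hsJ⟩

end

/-! ### Strong Gröbner bases over the localized coefficients -/

section
variable {τ A B : Type*} [CommRing A] [CommRing B] (m : MonomialOrder τ)

theorem MonomialOrder.degree_map_of_injective {φ : A →+* B} (hφ : Function.Injective φ)
    (f : MvPolynomial τ A) : m.degree (map φ f) = m.degree f := by
  rw [MonomialOrder.degree, MonomialOrder.degree, support_map_of_injective _ hφ]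

theorem MonomialOrder.leadingCoeff_map_of_injective {φ : A →+* B} (hφ : Function.Injective φ)
    (f : MvPolynomial τ A) : m.leadingCoeff (map φ f) = φ (m.leadingCoeff f) := by
  rw [MonomialOrder.leadingCoeff, m.degree_map_of_injective hφ, coeff_map]
  rfl

/-- The basic reduction step: subtracting a multiple of `g` with the same leading term as `f` lowers
the degree of `f`, unless nothing is left. -/
theorem MonomialOrder.degree_sub_monomial_mul_lt {f g : MvPolynomial τ A} {d : τ →₀ ℕ} {r : A}
    (hd : d + m.degree g = m.degree f) (hr : r * m.leadingCoeff g = m.leadingCoeff f)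
    (hne : f - monomial d r * g ≠ 0) :
    m.toSyn (m.degree (f - monomial d r * g)) < m.toSyn (m.degree f) := by
  refine lt_of_le_of_ne (m.degree_sub_le.trans (sup_le le_rfl ?_)) fun h => ?_
  · refine m.degree_mul_le.trans ?_
    rw [← hd, map_add, map_add]
    exact add_le_add_left (m.degree_monomial_le r) _
  · rw [m.toSyn.injective.eq_iff] at h
    refine m.coeff_degree_ne_zero_iff.mpr hne ?_
    rw [h, coeff_sub, ← hd, coeff_monomial_mul, hd, sub_eq_zero]
    exact hr.symm

end

section
variable {σ : Type*} {u : Finset σ} {m : MonomialOrder σ} {m₁ : MonomialOrder {i // i ∉ u}}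
  {m₂ : MonomialOrder {i // i ∈ u}} {A : Type*} [CommRing A]

theorem IsBlockOrder.degree_splitVars (hm : IsBlockOrder u m m₁ m₂) (f : MvPolynomial σ A) :
    m₁.degree (splitVars A u f) = (m.degree f).subtypeDomain (· ∉ u) := by
  classical
  by_cases hf : f = 0
  · simp [hf]
  apply m₁.toSyn.injective
  refine le_antisymm (m₁.degree_le_iff.mpr fun a ha => ?_) (m₁.le_degree ?_)
  · obtain ⟨b, hb⟩ := MvPolynomial.ne_zero_iff.mp (mem_support_iff.mp ha)
    obtain ⟨d, rfl, rfl⟩ : ∃ d : σ →₀ ℕ, d.subtypeDomain (· ∉ u) = a ∧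
        d.subtypeDomain (· ∈ u) = b :=
      ⟨b.piecewise a, by simp, by simp⟩
    rw [coeff_coeff_splitVars] at hb
    by_contra! h
    exact (m.le_degree (mem_support_iff.mpr hb)).not_gt ((hm _ _).mpr (Or.inl h))
  · rw [mem_support_iff]
    intro h
    refine m.coeff_degree_ne_zero_iff.mpr hf ?_
    rw [← coeff_coeff_splitVars u f, h, coeff_zero]

/-- If the leading coefficient in `A[u]` of some `f ∈ I` is not divisible by `q`, then `G` contains an
element with the same property whose leading monomial in `x ∖ u` divides that of `f`. Reduction
of `f` by elements of `G` whose leading coefficients `q` divides does not affect the hypotheses on `f`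
and lowers its degree in the block ordering. -/
theorem IsStrongGroebnerBasis.exists_not_dvd_leadingCoeff (hm : IsBlockOrder u m m₁ m₂)
    {G : Set (MvPolynomial σ A)} {I : Ideal (MvPolynomial σ A)} (hG : IsStrongGroebnerBasis m G I)
    (q : MvPolynomial {i // i ∈ u} A) {f : MvPolynomial σ A} (hf : f ∈ I)
    (hq : ¬ q ∣ m₁.leadingCoeff (splitVars A u f)) :
    ∃ g ∈ G, m₁.degree (splitVars A u g) ≤ m₁.degree (splitVars A u f) ∧
      ¬ q ∣ m₁.leadingCoeff (splitVars A u g) := by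
  induction h : m.toSyn (m.degree f) using WellFoundedLT.induction generalizing f with
  | _ s ih =>
  subst h
  have hf0 : f ≠ 0 := by
    rintro rfl
    simp at hq
  obtain ⟨g, hg, hgf⟩ := hG.2 f hf hf0
  obtain ⟨hdeg, r, hr⟩ := monomial_dvd_monomial.mp hgf
  replace hdeg := hdeg.resolve_left (m.leadingCoeff_ne_zero_iff.mpr hf0)
  obtain ⟨d, hd⟩ := exists_add_of_le hdeg
  rw [add_comm] at hd
  have hd₁ : m₁.degree (splitVars A u f) =
      d.subtypeDomain (· ∉ u) + m₁.degree (splitVars A u g) := by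
    rw [hm.degree_splitVars, hm.degree_splitVars, hd, Finsupp.subtypeDomain_add]
  by_cases hqg : q ∣ m₁.leadingCoeff (splitVars A u g)
  -- The coefficient of `f` at its leading monomial in `x ∖ u` changes by a multiple of `q` only; it
  -- stays nonzero, and `f - monomial d r * g` has the same leading monomial in `x ∖ u` as `f`.
  · have hcoeff : ¬ q ∣ coeff (m₁.degree (splitVars A u f))
        (splitVars A u (f - monomial d r * g)) := by
      rw [map_sub, map_mul, splitVars_monomial, coeff_sub]
      nth_rw 2 [hd₁]
      rw [coeff_monomial_mul]
      exact fun h => hq ((dvd_sub_left (Dvd.dvd.mul_left hqg _)).mp h)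
    have hne : f - monomial d r * g ≠ 0 := by
      intro h
      simp [h] at hcoeff
    have hlt := m.degree_sub_monomial_mul_lt hd.symm (by rw [mul_comm, hr]) hne
    have hdeg' : m₁.degree (splitVars A u (f - monomial d r * g)) =
        m₁.degree (splitVars A u f) := by
      apply m₁.toSyn.injective
      refine le_antisymm ?_ (m₁.le_degree ?_)
      · rw [hm.degree_splitVars, hm.degree_splitVars]
        by_contra! h
        exact hlt.not_gt ((hm _ _).mpr (Or.inl h))
      · rw [mem_support_iff]
        exact fun h => hcoeff (h ▸ dvd_zero q)
    have := ih _ hlt (I.sub_mem hf (I.mul_mem_left _ (hG.1 hg)))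
      (by rwa [MonomialOrder.leadingCoeff, hdeg']) rfl
    rwa [hdeg'] at this
  · exact ⟨g, hg, by rw [hd₁]; exact le_add_self, hqg⟩

end

theorem mem_pIdeal_iff {σ : Type*} {p : ℕ} {u : Finset σ} {s : MvPolynomial {i // i ∈ u} ℤ} :
    s ∈ pIdeal p u ↔ (p : MvPolynomial {i // i ∈ u} ℤ) ∣ s :=
  Ideal.mem_span_singleton

section
variable {σ : Type*} {p : ℕ} [hpr : Fact p.Prime] {u : Finset σ}

theorem prime_natCast_mvPolynomial (τ : Type*) : Prime (p : MvPolynomial τ ℤ) := by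
  have h : Prime (C (p : ℤ) : MvPolynomial τ ℤ) :=
    (prime_C_iff _).mpr (Nat.prime_iff_prime_int.mp hpr.out)
  simpa using h

theorem isUnit_algebraMap_locCoeff {s : MvPolynomial {i // i ∈ u} ℤ} (hs : s ∉ pIdeal p u) :
    IsUnit (algebraMap _ (LocCoeff p u) s) :=
  IsLocalization.map_units (M := (pIdeal p u).primeCompl) _ ⟨s, hs⟩

theorem finiteMultiplicity_natCast {τ : Type*} {c : MvPolynomial τ ℤ} (hc : c ≠ 0) :
    FiniteMultiplicity (p : MvPolynomial τ ℤ) c :=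
  FiniteMultiplicity.of_prime_left (prime_natCast_mvPolynomial τ) hc

/-- Divisibility in `R = ℤ[u]_⟨p⟩` is a comparison of `p`-adic valuations: if the valuation of `b` is
at most `k` and that of `c` at least `k`, then `b` divides `c` in `R`. -/
theorem algebraMap_locCoeff_dvd_of_not_pow_dvd {b c : MvPolynomial {i // i ∈ u} ℤ}
    {k : ℕ} (hb : ¬ (p : MvPolynomial {i // i ∈ u} ℤ) ^ (k + 1) ∣ b)
    (hc : (p : MvPolynomial {i // i ∈ u} ℤ) ^ k ∣ c) :
    algebraMap _ (LocCoeff p u) b ∣ algebraMap _ (LocCoeff p u) c := by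
  have hb0 : b ≠ 0 := by
    rintro rfl
    simp at hb
  obtain ⟨b', hb', hndvd⟩ :=
    (finiteMultiplicity_natCast (p := p) hb0).exists_eq_pow_mul_and_not_dvd
  have hle : multiplicity (p : MvPolynomial {i // i ∈ u} ℤ) b ≤ k := by
    by_contra! h
    exact hb ((pow_dvd_pow _ h).trans (pow_multiplicity_dvd _ _))
  rw [hb', map_mul, (isUnit_algebraMap_locCoeff (mt mem_pIdeal_iff.mp hndvd)).mul_right_dvd]
  exact map_dvd _ ((pow_dvd_pow _ hle).trans hc)

/-- Divisibility by a power of `p` descends from `R = ℤ[u]_⟨p⟩` to `ℤ[u]`. -/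
theorem pow_dvd_of_algebraMap_locCoeff_dvd {c : MvPolynomial {i // i ∈ u} ℤ} {k : ℕ}
    (h : algebraMap _ (LocCoeff p u) ((p : MvPolynomial {i // i ∈ u} ℤ) ^ k) ∣
      algebraMap _ (LocCoeff p u) c) : (p : MvPolynomial {i // i ∈ u} ℤ) ^ k ∣ c := by
  obtain ⟨r, hr⟩ := h
  obtain ⟨⟨a, s⟩, rfl⟩ := IsLocalization.mk'_surjective (pIdeal p u).primeCompl r
  have h : c * s = (p : MvPolynomial {i // i ∈ u} ℤ) ^ k * a := by
    apply algebraMap_locCoeff_injective p u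
    rw [map_mul, map_mul, hr, mul_assoc, IsLocalization.mk'_spec]
  exact (prime_natCast_mvPolynomial _).pow_dvd_of_dvd_mul_right k
    (mt mem_pIdeal_iff.mpr s.2) (Dvd.intro _ h.symm)

variable {m : MonomialOrder σ} {m₁ : MonomialOrder {i // i ∉ u}}
  {m₂ : MonomialOrder {i // i ∈ u}}

theorem leadingTerm_toLocPoly (f : MvPolynomial σ ℤ) :
    m₁.leadingTerm (toLocPoly p u f) = monomial (m₁.degree (splitVars ℤ u f))
      (algebraMap _ (LocCoeff p u) (m₁.leadingCoeff (splitVars ℤ u f))) := by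
  rw [MonomialOrder.leadingTerm, toLocPoly_apply,
    m₁.degree_map_of_injective (algebraMap_locCoeff_injective p u),
    m₁.leadingCoeff_map_of_injective (algebraMap_locCoeff_injective p u)]

theorem IsStrongGroebnerBasis.image_toLocPoly (hm : IsBlockOrder u m m₁ m₂)
    {G : Set (MvPolynomial σ ℤ)} {I : Ideal (MvPolynomial σ ℤ)}
    (hG : IsStrongGroebnerBasis m G I) :
    IsStrongGroebnerBasis m₁ (toLocPoly p u '' G) (I.map (toLocPoly p u)) := by
  refine ⟨?_, fun F hF hF0 => ?_⟩
  · rintro _ ⟨g, hg, rfl⟩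
    exact Ideal.mem_map_of_mem _ (hG.1 hg)
  obtain ⟨s, hs, f, hf, hsF⟩ := (mem_map_toLocPoly_iff p u).mp hF
  have hsu := isUnit_algebraMap_locCoeff hs
  have hf0 : splitVars ℤ u f ≠ 0 := by
    rw [Ne, EmbeddingLike.map_eq_zero_iff]
    rintro rfl
    rw [map_zero, (hsu.map C).mul_right_eq_zero] at hsF
    exact hF0 hsF
  have hfin := finiteMultiplicity_natCast (p := p) (m₁.leadingCoeff_ne_zero_iff.mpr hf0)
  obtain ⟨g, hg, hdeg, hndvd⟩ := hG.exists_not_dvd_leadingCoeff hm _ hf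
    (hfin.not_pow_dvd_of_multiplicity_lt (Nat.lt_succ_self _))
  refine ⟨_, ⟨g, hg, rfl⟩, ?_⟩
  have h : m₁.leadingTerm (toLocPoly p u g) ∣ m₁.leadingTerm (toLocPoly p u f) := by
    rw [leadingTerm_toLocPoly, leadingTerm_toLocPoly, monomial_dvd_monomial]
    exact ⟨Or.inr hdeg, algebraMap_locCoeff_dvd_of_not_pow_dvd hndvd (pow_multiplicity_dvd _ _)⟩
  rwa [← hsF, m₁.leadingTerm_mul, m₁.leadingTerm_C, (hsu.map C).dvd_mul_left] at h

theorem IsStrongGroebnerBasis.comap_map_toLocPoly_eq_saturationIdeal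
    (hm : IsBlockOrder u m m₁ m₂) {ι : Type*} [Finite ι] {g : ι → MvPolynomial σ ℤ}
    {I : Ideal (MvPolynomial σ ℤ)} (hG : IsStrongGroebnerBasis m (Set.range g) I)
    {ν : ι → ℕ} {a : ι → MvPolynomial {i // i ∈ u} ℤ} {β : ι → ({i // i ∉ u} →₀ ℕ)}
    {h : MvPolynomial {i // i ∈ u} ℤ} (ha : ∀ i, a i ∉ pIdeal p u)
    (hlt : ∀ i, m₁.leadingTerm (toLocPoly p u (g i)) =
      monomial (β i) (algebraMap (MvPolynomial {i // i ∈ u} ℤ) (LocCoeff p u)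
        ((p : MvPolynomial {i // i ∈ u} ℤ) ^ ν i * a i)))
    (hh : IsLeastCommonMultiple a h) :
    (I.map (toLocPoly p u)).comap (toLocPoly p u) = saturationIdeal I (inclVars ℤ u h) := by
  have := Fintype.ofFinite ι
  have hhp : h ∉ pIdeal p u := by
    intro hmem
    have hprod : ∏ i, a i ∈ pIdeal p u :=
      Ideal.mem_of_dvd _ (hh.2 _ fun i => Finset.dvd_prod_of_mem a (Finset.mem_univ i)) hmem
    obtain ⟨i, -, hi⟩ := (pIdeal_isPrime p u).prod_mem_iff.mp hprod
    exact ha i hi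
  have hh0 : h ≠ 0 := fun h0 => hhp (h0 ▸ zero_mem _)
  have hlead (i : ι) : m₁.degree (splitVars ℤ u (g i)) = β i ∧
      m₁.leadingCoeff (splitVars ℤ u (g i)) = (p : MvPolynomial {i // i ∈ u} ℤ) ^ ν i * a i := by
    have hne : (p : MvPolynomial {i // i ∈ u} ℤ) ^ ν i * a i ≠ 0 :=
      mul_ne_zero (pow_ne_zero _ (prime_natCast_mvPolynomial _).ne_zero)
        fun h0 => ha i (h0 ▸ zero_mem _)
    have hne' := (map_ne_zero_iff _ (algebraMap_locCoeff_injective p u)).mpr hne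
    have h1 := hlt i
    rw [leadingTerm_toLocPoly] at h1
    rcases monomial_eq_monomial_iff _ _ _ _ |>.mp h1 with h2 | h2
    · exact ⟨h2.1, algebraMap_locCoeff_injective p u h2.2⟩
    · exact absurd h2.2 hne'
  ext f
  refine ⟨fun hf => ?_, fun ⟨k, hk⟩ => ?_⟩
  · induction hs : m₁.toSyn (m₁.degree (splitVars ℤ u f)) using WellFoundedLT.induction
      generalizing f with
    | _ s ih =>
    subst hs
    by_cases hf0 : f = 0
    · exact hf0 ▸ zero_mem _
    obtain ⟨_, ⟨_, ⟨i, rfl⟩, rfl⟩, hdvd⟩ := (hG.image_toLocPoly (p := p) hm).2 _ hf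
      ((map_ne_zero_iff _ (toLocPoly_injective p u)).mpr hf0)
    have hφf : splitVars ℤ u f ≠ 0 := by simpa using hf0
    rw [leadingTerm_toLocPoly, leadingTerm_toLocPoly, monomial_dvd_monomial, (hlead i).2] at hdvd
    obtain ⟨hdeg, hcoeff⟩ := hdvd
    replace hdeg := hdeg.resolve_left <|
      (map_ne_zero_iff _ (algebraMap_locCoeff_injective p u)).mpr
        (m₁.leadingCoeff_ne_zero_iff.mpr hφf)
    obtain ⟨c, hc⟩ := pow_dvd_of_algebraMap_locCoeff_dvd
      ((map_dvd _ (Dvd.intro _ rfl)).trans hcoeff)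
    -- With `lc f = p ^ ν i * c` and `h = a i * b`, the leading coefficient `h * lc f` of `h * f` is
    -- `b * c` times that of `g i`.
    obtain ⟨b, hb⟩ := hh.1 i
    obtain ⟨d, hd⟩ := exists_add_of_le hdeg
    have hCh : (C h : MvPolynomial {i // i ∉ u} (MvPolynomial {i // i ∈ u} ℤ)) ≠ 0 := by
      simpa using hh0
    have hdegh : m₁.degree (C h * splitVars ℤ u f) = m₁.degree (splitVars ℤ u f) := by
      rw [m₁.degree_mul hCh hφf, m₁.degree_C, zero_add]
    have hlch : m₁.leadingCoeff (C h * splitVars ℤ u f) = h * m₁.leadingCoeff (splitVars ℤ u f) := by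
      rw [m₁.leadingCoeff_mul, m₁.leadingCoeff_C]
    set t := (splitVars ℤ u).symm (monomial d (b * c)) with ht
    have hmem : t * g i ∈ I := I.mul_mem_left _ (hG.1 ⟨i, rfl⟩)
    have hsplit : splitVars ℤ u (inclVars ℤ u h * f - t * g i) =
        C h * splitVars ℤ u f - monomial d (b * c) * splitVars ℤ u (g i) := by
      rw [map_sub, map_mul, map_mul, splitVars_inclVars, ht, RingEquiv.apply_symm_apply]
    have hred : inclVars ℤ u h * f - t * g i ∈ saturationIdeal I (inclVars ℤ u h) := by
      by_cases hne : inclVars ℤ u h * f - t * g i = 0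
      · exact hne ▸ zero_mem _
      refine ih _ ?_ _ ?_ rfl
      · rw [hsplit, ← hdegh]
        refine m₁.degree_sub_monomial_mul_lt ?_ ?_ ?_
        · rw [hdegh, hd, add_comm]
        · rw [hlch, (hlead i).2, hc, hb]
          ring
        · rwa [← hsplit, Ne, EmbeddingLike.map_eq_zero_iff]
      · exact sub_mem (Ideal.mul_mem_left _ _ hf) (Ideal.mem_map_of_mem _ hmem)
    obtain ⟨k, hk⟩ := hred
    refine ⟨k + 1, ?_⟩
    have e : inclVars ℤ u h ^ (k + 1) * f = inclVars ℤ u h ^ k * (inclVars ℤ u h * f - t * g i) +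
        inclVars ℤ u h ^ k * (t * g i) := by ring
    rw [e]
    exact I.add_mem hk (I.mul_mem_left _ hmem)
  · rw [mem_comap_map_toLocPoly_iff]
    refine ⟨h ^ k, fun hmem => hhp ((pIdeal_isPrime p u).mem_of_pow_mem k hmem), ?_⟩
    rwa [map_pow]

end

theorem lemma2p4 (n : ℕ) (I Q J P : Ideal (MvPolynomial (Fin n) ℤ)) (p : ℕ) [Fact p.Prime]
    (u : Finset (Fin n))
    (hIQJ : I = Q ⊓ J)
    (hI : IsPseudoPrimary I) (hIP : I.radical = P)
    (hQ : Q.IsPrimary) (hQP : Q.radical = P)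
    (hht : Q.height < J.height)
    (hPp : P.comap (MvPolynomial.C : ℤ →+* MvPolynomial (Fin n) ℤ) = Ideal.span {(p : ℤ)})
    (hu : IsMaximalIndependentSet u
      (P.map (MvPolynomial.map (σ := Fin n) (Int.castRingHom (ZMod p))))) :
    (I.map (toLocPoly p u)).comap (toLocPoly p u) = Q ∧
    ∀ (m : MonomialOrder (Fin n)) (m₁ : MonomialOrder {i // i ∉ u})
      (m₂ : MonomialOrder {i // i ∈ u}), IsBlockOrder u m m₁ m₂ →
      (∀ G : Set (MvPolynomial (Fin n) ℤ), IsStrongGroebnerBasis m G I →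
        IsStrongGroebnerBasis m₁ (toLocPoly p u '' G) (I.map (toLocPoly p u))) ∧
      (∀ (k : ℕ) (g : Fin k → MvPolynomial (Fin n) ℤ),
        IsStrongGroebnerBasis m (Set.range g) I →
        ∀ (ν : Fin k → ℕ) (a : Fin k → MvPolynomial {i // i ∈ u} ℤ)
          (β : Fin k → ({i // i ∉ u} →₀ ℕ)) (h : MvPolynomial {i // i ∈ u} ℤ),
          (∀ i, a i ∉ pIdeal p u) →
          (∀ i, m₁.leadingTerm (toLocPoly p u (g i)) =
            MvPolynomial.monomial (β i) (algebraMap (MvPolynomial {i // i ∈ u} ℤ)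
              (LocCoeff p u) ((p : MvPolynomial {i // i ∈ u} ℤ) ^ ν i * a i))) →
          IsLeastCommonMultiple a h →
          (I.map (toLocPoly p u)).comap (toLocPoly p u) =
            saturationIdeal I (inclVars ℤ u h)) := by
  subst hIQJ
  have hpP : (p : MvPolynomial (Fin n) ℤ) ∈ P := by
    have h : (p : ℤ) ∈ P.comap (C : ℤ →+* MvPolynomial (Fin n) ℤ) :=
      hPp ▸ Ideal.mem_span_singleton_self _
    simpa using h
  have hPJ : P ≤ J.radical := hIP ▸ Ideal.radical_mono inf_le_right
  exact ⟨comap_map_toLocPoly_eq_of_height_lt p hQ hQP hPJ hht hpP hu,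
    fun m m₁ m₂ hm => ⟨fun G hG => hG.image_toLocPoly hm,
      fun k g hG ν a β h ha hlt hh => hG.comap_map_toLocPoly_eq_saturationIdeal hm ha hlt hh⟩⟩
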